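/- Let $H$ be a locally compact CAT($-1$) space with geodesic boundary $\partial H$ (asymptote classes of geodesic rays), and suppose that $H$ has extendible geodesics: any two distinct points of $H$ lie on a bi-infinite geodesic. Let a group $G$ act on $H$ by isometries and cocompactly, i.e. the $G$-translates of some compact subset cover $H$. For $p\in H$ and $\xi,\eta\in\partial H$ let $(\xi\cdot\eta)_p\in[0,\infty]$ be the Gromov product, i.e. the limit as $s,t\to\infty$ of $(x_s\cdot y_t)_p=\frac12\big(d(x_s,p)+d(y_t,p)-d(x_s,y_t)\big)$, where $x_s$, $y_t$ are the points at distance $s$, $t$ from $p$ on the geodesic rays from $p$ to $\xi$, $\eta$. Suppose there is a $K<-1$ such that for every triangle with one vertex $p\in H$ and two distinct vertices $\xi,\eta\in\partial H$ at least one of the following holds: 1. the rays from $p$ to $\xi$ and from $p$ to $\eta$ have a common nontrivial initial segment; 2. the triangle is fatter than its comparison triangle in the plane $\mathbb{H}^2_K$ of constant curvature $K$: if $\bar p\in\mathbb{H}^2_K$ and $\bar\xi,\bar\eta\in\partial\mathbb{H}^2_K$ satisfy $(\bar\xi\cdot\bar\eta)_{\bar p}=(\xi\cdot\eta)_p$,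 and $\bar x_s$, $\bar y_t$ denote the points at distance $s$, $t$ from $\bar p$ on the rays from $\bar p$ to $\bar\xi$, $\bar\eta$, then $d(x_s,y_t)\ge d(\bar x_s,\bar y_t)$ for all $s,t\ge 0$. Then $H$ has bounded flip: there are constants $R_1,R_2>0$ such that for all $\zeta,\nu\in\partial H$ and all $p\in H$ there exist bi-infinite unit speed geodesics $\gamma_1,\gamma_2$ in $H$ with $\gamma_1(0)=\gamma_2(0)=p$, with forward endpoints $\gamma_1^+=\zeta$, $\gamma_2^+=\nu$, and with backward endpoints satisfying $$(\gamma_1^-\cdot\gamma_2^-)_p\ \ge\ R_1\,(\gamma_1^+\cdot\gamma_2^+)_p-R_2 .$$ -/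

import Mathlib

open Filter Topology
open scoped NNReal

/-- The plane of constant curvature `K < 0`: the hyperbolic plane (Mathlib's upper half-plane,
whose metric has curvature `-1`) with its metric divided by `√(-K)`. -/
def HypPlane (_K : Set.Iio (0 : ℝ)) : Type := UpperHalfPlane

namespace HypPlane

/-- The underlying point of the upper half-plane. -/
def toUpper {K : Set.Iio (0 : ℝ)} (z : HypPlane K) : UpperHalfPlane := z

theorem sqrt_neg_pos (K : Set.Iio (0 : ℝ)) : 0 < Real.sqrt (-(K : ℝ)) :=
  Real.sqrt_pos.mpr (neg_pos.mpr K.2)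

noncomputable instance (K : Set.Iio (0 : ℝ)) : MetricSpace (HypPlane K) where
  dist z w := dist z.toUpper w.toUpper / Real.sqrt (-(K : ℝ))
  dist_self z := by simp
  dist_comm z w := by rw [dist_comm]
  dist_triangle x y z := by
    rw [← add_div]
    exact div_le_div_of_nonneg_right (dist_triangle _ _ _) (sqrt_neg_pos K).le
  eq_of_dist_eq_zero {x y} h := by
    rcases div_eq_zero_iff.mp h with h | h
    · exact (dist_eq_zero (γ := UpperHalfPlane)).mp h
    · exact absurd h (sqrt_neg_pos K).ne'

end HypPlane

/-- Any two points are joined by a geodesic segment. -/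
def IsGeodesicSpace (X : Type*) [MetricSpace X] : Prop :=
  ∀ x y : X, ∃ c : ℝ → X, c 0 = x ∧ c (dist x y) = y ∧
    ∀ s ∈ Set.Icc 0 (dist x y), ∀ t ∈ Set.Icc 0 (dist x y), dist (c s) (c t) = |s - t|

/-- `X` is a CAT(`K`) space, `K < 0`: it is a geodesic space, and every geodesic triangle
`x, y, z` has a comparison triangle `x', y', z'` in the plane of curvature `K` such that distances
between points of two sides are at most the distances between the comparison points. (In a
geodesic space, `p` lies on a geodesic segment from `x` to `y` if and only if
`dist x p + dist p y = dist x y`.) -/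
def IsCAT (K : Set.Iio (0 : ℝ)) (X : Type*) [MetricSpace X] : Prop :=
  IsGeodesicSpace X ∧
  ∀ x y z : X, ∃ x' y' z' : HypPlane K,
    dist x' y' = dist x y ∧ dist x' z' = dist x z ∧ dist y' z' = dist y z ∧
    ∀ (p q : X) (p' q' : HypPlane K),
      dist x p + dist p y = dist x y → dist x q + dist q z = dist x z →
      dist x' p' = dist x p → dist p' y' = dist p y →
      dist x' q' = dist x q → dist q' z' = dist q z →
      dist p q ≤ dist p' q'

/-- The CAT(-1) condition. -/
def IsCATNegOne (X : Type*) [MetricSpace X] : Prop :=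
  IsCAT ⟨-1, by norm_num⟩ X

/-- Unit speed geodesic rays. -/
structure GeodesicRay (X : Type*) [MetricSpace X] where
  toFun : ℝ≥0 → X
  isometry : Isometry toFun

/-- Bi-infinite unit speed geodesics. -/
structure GeodesicLine (X : Type*) [MetricSpace X] where
  toFun : ℝ → X
  isometry : Isometry toFun

instance (X : Type*) [MetricSpace X] : CoeFun (GeodesicRay X) (fun _ => ℝ≥0 → X) :=
  ⟨GeodesicRay.toFun⟩

instance (X : Type*) [MetricSpace X] : CoeFun (GeodesicLine X) (fun _ => ℝ → X) :=
  ⟨GeodesicLine.toFun⟩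

/-- Two rays are asymptotic if they stay at bounded distance from each other. -/
instance asymptoticSetoid (X : Type*) [MetricSpace X] : Setoid (GeodesicRay X) where
  r f g := ∃ C : ℝ, ∀ t, dist (f t) (g t) ≤ C
  iseqv :=
    { refl := fun _ => ⟨0, fun _ => by simp⟩
      symm := fun ⟨C, h⟩ => ⟨C, fun t => by rw [dist_comm]; exact h t⟩
      trans := fun ⟨C, h⟩ ⟨D, k⟩ =>
        ⟨C + D, fun t => (dist_triangle _ _ _).trans (add_le_add (h t) (k t))⟩ }

/-- The geodesic boundary `∂X`: asymptote classes of geodesic rays. -/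
def IdealBoundary (X : Type*) [MetricSpace X] : Type _ := Quotient (asymptoticSetoid X)

/-- The endpoint at infinity of a ray. -/
def GeodesicRay.endpoint {X : Type*} [MetricSpace X] (f : GeodesicRay X) : IdealBoundary X :=
  Quotient.mk (asymptoticSetoid X) f

namespace GeodesicLine

variable {X : Type*} [MetricSpace X]

/-- The ray `t ↦ γ t`, `t ≥ 0`. -/
def forward (γ : GeodesicLine X) : GeodesicRay X where
  toFun t := γ (t : ℝ)
  isometry := γ.isometry.comp isometry_subtype_coe

/-- The ray `t ↦ γ (-t)`, `t ≥ 0`. -/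
def backward (γ : GeodesicLine X) : GeodesicRay X where
  toFun t := γ (-(t : ℝ))
  isometry := γ.isometry.comp ((IsometryEquiv.neg ℝ).isometry.comp isometry_subtype_coe)

end GeodesicLine

/-- The Gromov product `(x · y)_p`. -/
noncomputable def gromovProduct {X : Type*} [MetricSpace X] (p x y : X) : ℝ :=
  (dist x p + dist y p - dist x y) / 2

/-- The Gromov product `(ξ · η)_p ∈ [0, ∞]` of the endpoints at infinity of two rays `f`, `g`
that issue from the same point `p`: the limit of `(f s · g t)_p` as `s, t → ∞`. (This quantity is
nondecreasing in `s` and `t`, so that the lower limit is a limit.) -/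
noncomputable def rayGromovProduct {X : Type*} [MetricSpace X] (f g : GeodesicRay X) : EReal :=
  liminf (fun r : ℝ≥0 × ℝ≥0 => ((gromovProduct (f 0) (f r.1) (g r.2) : ℝ) : EReal)) atTop

/-- Every pair of distinct points lies on a bi-infinite geodesic. -/
def HasGeodesicExtension (X : Type*) [MetricSpace X] : Prop :=
  ∀ p q : X, p ≠ q → ∃ γ : GeodesicLine X, γ 0 = p ∧ γ (dist p q) = q

/-- The action of `G` on `X` is cocompact: the translates of some compact set cover `X`. -/
def ActsCocompactly (G X : Type*) [Group G] [MetricSpace X] [MulAction G X] : Prop :=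
  ∃ C : Set X, IsCompact C ∧ ∀ x : X, ∃ g : G, ∃ y ∈ C, g • y = x

/-- The two sides `f`, `g` of a triangle with interior vertex `f 0 = g 0` meet that vertex along
a common nontrivial segment. -/
def ShareInitialSegment {X : Type*} [MetricSpace X] (f g : GeodesicRay X) : Prop :=
  ∃ ε : ℝ≥0, 0 < ε ∧ ∀ t ≤ ε, f t = g t

/-- The triangle with interior vertex `f 0 = g 0` and ideal vertices the endpoints of `f` and `g`
is fatter than its comparison triangle in the plane of curvature `K`. The comparison triangle has
one interior and two ideal vertices, with the same Gromov product of the ideal vertices seen from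
the interior one (the only isometry invariant of such a triangle in the plane), and points on the
two sides at the interior vertex are at least as far apart as their comparison points. -/
def FatterThanComparison (K : Set.Iio (0 : ℝ)) {X : Type*} [MetricSpace X]
    (f g : GeodesicRay X) : Prop :=
  ∃ f' g' : GeodesicRay (HypPlane K), f' 0 = g' 0 ∧
    rayGromovProduct f' g' = rayGromovProduct f g ∧
    ∀ s t : ℝ≥0, dist (f' s) (g' t) ≤ dist (f s) (g t)

/-- Bounded flip. -/
def HasBoundedFlip (X : Type*) [MetricSpace X] : Prop :=
  ∃ R₁ R₂ : ℝ, 0 < R₁ ∧ 0 < R₂ ∧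
    ∀ (ζ ν : IdealBoundary X) (p : X), ∃ γ₁ γ₂ : GeodesicLine X,
      γ₁.forward.endpoint = ζ ∧ γ₂.forward.endpoint = ν ∧ γ₁ 0 = p ∧ γ₂ 0 = p ∧
      rayGromovProduct γ₁.backward γ₂.backward ≥
        (R₁ : EReal) * rayGromovProduct γ₁.forward γ₂.forward - (R₂ : EReal)

/-! Let `γ₁`, `γ₂` be lines through `p` that extend the rays from `p` to `ζ` and `ν`, and let `h` be
the ray from `γ₂ 1` to `γ₁⁻`. If `h` passes through `p`, its tail continues `γ₂` backwards, because
local geodesics are geodesics. The new line through `p` ends backwards at `γ₁⁻`, so the backward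
product is infinite.

Otherwise `h` leaves `γ₂` at some `γ₂ ℓ` with `0 < ℓ ≤ 1`. The triangle with vertices `γ₂ ℓ`, `γ₁⁻`,
`γ₂⁻` has no common initial segment there, so it is fat. If the forward product exceeds `A`, CAT(-1)
comparison makes `γ₁ ℓ` and `γ₂ ℓ` at most `12 ℓ exp (-A)` apart, so `h` passes within `36 ℓ exp
(-A)` of `p` at time `ℓ`. By fatness the comparison rays are at least as close at time `ℓ`, and in
curvature `K` this forces their product to be at least `A / √(-K) - C`. Moving the base point from
`γ₂ ℓ` back to `p` costs a bounded amount.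

Since `ℓ` has no positive lower bound, the estimates must be linear in `ℓ`: only the ratio of
distance to `ℓ`, in effect the angle, survives. Both directions rest on the chord law that `sinh (d
/ 2) / sinh t` is constant along two rays from a point in the hyperbolic plane
(`UpperHalfPlane.isosceles`) and nondecreasing in a CAT(-1) space (`GeodesicRay.isosceles`). -/

/-! ### Hyperbolic trigonometry in the hyperboloid model. -/

open Real in
/-- Stewart-type identity behind the hyperboloid model. -/
theorem sinh_add_sq (s r : ℝ) :
    sinh (s + r) ^ 2 = sinh r ^ 2 + sinh s ^ 2 + 2 * sinh r * sinh s * cosh (s + r) := by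
  rw [sinh_add, cosh_add]
  have h1 := cosh_sq s
  have h2 := cosh_sq r
  linear_combination (sinh r ^ 2) * h1 + (sinh s ^ 2) * h2

/-- The Minkowski form of signature `(1, 2)` on `ℝ³`, in light cone coordinates. -/
noncomputable def mink (v w : ℝ × ℝ × ℝ) : ℝ := (v.2.1 * w.2.2 + v.2.2 * w.2.1) / 2 - v.1 * w.1

theorem mink_comm (v w : ℝ × ℝ × ℝ) : mink v w = mink w v := by
  simp only [mink]; ring

theorem mink_add (u v w : ℝ × ℝ × ℝ) : mink (u + v) w = mink u w + mink v w := by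
  simp only [mink, Prod.fst_add, Prod.snd_add]; ring

theorem mink_smul (a : ℝ) (v w : ℝ × ℝ × ℝ) : mink (a • v) w = a * mink v w := by
  simp only [mink, Prod.smul_fst, Prod.smul_snd, smul_eq_mul]; ring

theorem mink_add_right (u v w : ℝ × ℝ × ℝ) : mink w (u + v) = mink w u + mink w v := by
  rw [mink_comm, mink_add, mink_comm u, mink_comm v]

theorem mink_smul_right (a : ℝ) (v w : ℝ × ℝ × ℝ) : mink w (a • v) = a * mink w v := by
  rw [mink_comm, mink_smul, mink_comm v]

/-- An isotropic vector orthogonal to a timelike unit vector vanishes. -/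
theorem eq_zero_of_mink_eq_zero {v o : ℝ × ℝ × ℝ} (ho : mink o o = 1) (hv : mink v v = 0)
    (hvo : mink v o = 0) : v = 0 := by
  obtain ⟨v1, v2, v3⟩ := v
  obtain ⟨o1, o2, o3⟩ := o
  simp only [mink] at ho hv hvo
  have hsq : (v2 * o3 - v3 * o2) ^ 2 + 4 * v1 ^ 2 = 0 := by
    linear_combination (2 * (v2 * o3 + v3 * o2) + 4 * v1 * o1) * hvo - 4 * o2 * o3 * hv -
      4 * v1 ^ 2 * ho
  have h1 : v1 = 0 := by nlinarith [sq_nonneg (v2 * o3 - v3 * o2), sq_nonneg v1]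
  subst h1
  have h2 : v2 * o3 - v3 * o2 = 0 := by nlinarith [sq_nonneg (v2 * o3 - v3 * o2)]
  have h3 : v2 * o3 = 0 := by linarith
  have h4 : v3 * o2 = 0 := by linarith
  have ho2 : o2 ≠ 0 := by rintro rfl; nlinarith [sq_nonneg o1]
  have ho3 : o3 ≠ 0 := by rintro rfl; nlinarith [sq_nonneg o1]
  simp_all

namespace UpperHalfPlane

/-- The point of the hyperboloid corresponding to a point of the upper half-plane. -/
noncomputable def lift (z : UpperHalfPlane) : ℝ × ℝ × ℝ :=
  (z.re / z.im, 1 / z.im, (z.re ^ 2 + z.im ^ 2) / z.im)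

theorem cosh_dist_eq_mink (z w : UpperHalfPlane) : Real.cosh (dist z w) = mink z.lift w.lift := by
  have hz := z.im_pos.ne'
  have hw := w.im_pos.ne'
  rw [UpperHalfPlane.cosh_dist, Complex.dist_eq, Complex.sq_norm, Complex.normSq_apply]
  simp only [mink, lift, Complex.sub_re, Complex.sub_im, coe_re, coe_im]
  field_simp
  ring

theorem mink_lift_self (z : UpperHalfPlane) : mink z.lift z.lift = 1 := by
  rw [← cosh_dist_eq_mink, dist_self, Real.cosh_zero]

theorem exists_lift_eq {v : ℝ × ℝ × ℝ} (hv : mink v v = 1) (hpos : 0 < v.2.1) :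
    ∃ z : UpperHalfPlane, z.lift = v := by
  obtain ⟨v1, v2, v3⟩ := v
  simp only [mink] at hv hpos
  refine ⟨⟨⟨v1 / v2, 1 / v2⟩, by simpa using hpos⟩, ?_⟩
  have h2 := hpos.ne'
  have h3 : v2 * v3 = v1 ^ 2 + 1 := by linarith
  simp only [lift, UpperHalfPlane.re, UpperHalfPlane.im, Prod.mk.injEq]
  refine ⟨by field_simp, by field_simp, ?_⟩
  field_simp
  linarith

theorem dist_eq_of_cosh {z w : UpperHalfPlane} {t : ℝ} (ht : 0 ≤ t)
    (h : mink z.lift w.lift = Real.cosh t) : dist z w = t := by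
  rw [← cosh_dist_eq_mink] at h
  exact Real.cosh_strictMonoOn.injOn (Set.mem_Ici.mpr dist_nonneg) (Set.mem_Ici.mpr ht) h

open Real in
/-- Stewart's theorem in the hyperbolic plane. -/
theorem stewart {o m x : UpperHalfPlane} (h : dist o m + dist m x = dist o x)
    (w : UpperHalfPlane) :
    sinh (dist o x) * cosh (dist m w) =
      sinh (dist m x) * cosh (dist o w) + sinh (dist o m) * cosh (dist x w) := by
  set s := dist o m
  set r := dist m x
  have ho : cosh s = mink o.lift m.lift := cosh_dist_eq_mink _ _
  have hm : cosh r = mink m.lift x.lift := cosh_dist_eq_mink _ _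
  have hx : cosh (s + r) = mink o.lift x.lift := by rw [h]; exact cosh_dist_eq_mink _ _
  -- `V = 0` expresses `m` as a combination of `o` and `x` on the hyperboloid; pairing it with `w`
  -- is Stewart's identity.
  set V := sinh (s + r) • m.lift + ((-sinh r) • o.lift + (-sinh s) • x.lift) with hV
  have hm1 := mink_lift_self m
  have hx1 := mink_lift_self x
  have ho1 := mink_lift_self o
  have hsq := sinh_add_sq s r
  have e1 := sinh_add s r
  have e2 : sinh r = sinh (s + r) * cosh s - cosh (s + r) * sinh s := by
    rw [← sinh_sub, add_sub_cancel_left]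
  have hVo : mink V o.lift = 0 := by
    rw [hV]
    simp only [mink_add, mink_smul]
    rw [mink_comm m.lift, mink_comm x.lift, ← ho, ← hx, ho1]
    linear_combination -e2
  have hVV : mink V V = 0 := by
    rw [hV]
    simp only [mink_add, mink_smul, mink_add_right, mink_smul_right]
    rw [mink_comm m.lift o.lift, mink_comm x.lift o.lift, mink_comm x.lift m.lift,
      ← ho, ← hx, ← hm, ho1, hm1, hx1]
    linear_combination -hsq + 2 * sinh (s + r) * e1
  have hz := eq_zero_of_mink_eq_zero ho1 hVV hVo
  have hw : mink V w.lift = 0 := by rw [hz]; simp [mink]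
  rw [hV] at hw
  simp only [mink_add, mink_smul] at hw
  rw [cosh_dist_eq_mink, cosh_dist_eq_mink, cosh_dist_eq_mink, ← h]
  linarith

open Real in
theorem exists_between (o x : UpperHalfPlane) {s r : ℝ} (hs : 0 ≤ s) (hr : 0 ≤ r)
    (h : s + r = dist o x) : ∃ m : UpperHalfPlane, dist o m = s ∧ dist m x = r := by
  rcases (add_nonneg hs hr).eq_or_lt with h0 | h0
  · have hs0 : s = 0 := by linarith
    have hr0 : r = 0 := by linarith
    exact ⟨o, by simp [hs0], by rw [← h, hs0, hr0, add_zero]⟩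
  have hS : 0 < sinh (s + r) := sinh_pos_iff.mpr h0
  have hox : mink o.lift x.lift = cosh (s + r) := by rw [h]; exact (cosh_dist_eq_mink _ _).symm
  have hx1 := mink_lift_self x
  have ho1 := mink_lift_self o
  set v := (sinh (s + r))⁻¹ • (sinh r • o.lift + sinh s • x.lift) with hv
  have hvv : mink v v = 1 := by
    rw [hv]
    simp only [mink_add, mink_smul, mink_add_right, mink_smul_right]
    rw [mink_comm x.lift o.lift, hox, ho1, hx1]
    have := sinh_add_sq s r
    field_simp
    linarith
  have hpos : 0 < v.2.1 := by
    simp only [hv, lift, Prod.smul_fst, Prod.smul_snd, Prod.fst_add, Prod.snd_add, smul_eq_mul]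
    have h1 := sinh_nonneg_iff.mpr hs
    have h2 := sinh_nonneg_iff.mpr hr
    have h3 : 0 < 1 / o.im := one_div_pos.mpr o.im_pos
    have h4 : 0 < 1 / x.im := one_div_pos.mpr x.im_pos
    refine mul_pos (inv_pos.mpr hS) ?_
    rcases hs.eq_or_lt with h5 | h5
    · have : 0 < sinh r := sinh_pos_iff.mpr (by linarith)
      positivity
    · have : 0 < sinh s := sinh_pos_iff.mpr h5
      positivity
  obtain ⟨m, hm⟩ := exists_lift_eq hvv hpos
  refine ⟨m, dist_eq_of_cosh hs ?_, dist_eq_of_cosh hr ?_⟩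
  · rw [hm, hv]
    simp only [mink_add_right, mink_smul_right]
    rw [hox, ho1]
    have e2 : sinh r = sinh (s + r) * cosh s - cosh (s + r) * sinh s := by
      rw [← sinh_sub, add_sub_cancel_left]
    rw [e2]
    field_simp
    ring
  · rw [hm, hv]
    simp only [mink_add, mink_smul]
    rw [hox, hx1]
    have e2 : sinh s = sinh (s + r) * cosh r - cosh (s + r) * sinh r := by
      rw [← sinh_sub, add_sub_cancel_right]
    rw [e2]
    field_simp
    ring

open Real in
theorem cosh_sub_one (x : ℝ) : cosh x - 1 = 2 * sinh (x / 2) ^ 2 := by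
  have h := cosh_two_mul (x / 2)
  rw [mul_div_cancel₀ x two_ne_zero] at h
  have := cosh_sq (x / 2)
  linarith

open Real in
/-- Two sides of equal length at a vertex: the chords cut off at distance `t` from the vertex. -/
theorem isosceles {o x y m n : UpperHalfPlane} {t r : ℝ} (hm : dist o m = t) (hm' : dist m x = r)
    (hn : dist o n = t) (hn' : dist n y = r) (hx : dist o x = t + r) (hy : dist o y = t + r) :
    sinh (t + r) * sinh (dist m n / 2) = sinh t * sinh (dist x y / 2) := by
  have ht : 0 ≤ t := hm ▸ dist_nonneg
  have hr : 0 ≤ r := hm' ▸ dist_nonneg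
  -- Stewart is applied twice: `m` on side `ox` seen from `n`, then `n` on side `oy` seen from `x`.
  -- This eliminates the diagonal from `x` to `n`.
  have h1 := stewart (o := o) (m := m) (x := x) (by rw [hm, hm', hx]) n
  have h2 := stewart (o := o) (m := n) (x := y) (by rw [hn, hn', hy]) x
  rw [hx, hm', hn, hm] at h1
  rw [hy, hn', hx, hn] at h2
  rw [dist_comm n x] at h2
  rw [dist_comm y x] at h2
  have e1 := cosh_sub_one (dist m n)
  have e2 := cosh_sub_one (dist x y)
  have hsq := sinh_add_sq t r
  have e3 : sinh r = sinh (t + r) * cosh t - cosh (t + r) * sinh t := by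
    rw [← sinh_sub, add_sub_cancel_left]
  have key : (sinh (t + r) * sinh (dist m n / 2)) ^ 2 = (sinh t * sinh (dist x y / 2)) ^ 2 := by
    have : sinh (t + r) ^ 2 * cosh (dist m n) = sinh (t + r) * (sinh r * cosh t) +
        sinh t * (sinh r * cosh (t + r) + sinh t * cosh (dist x y)) := by
      rw [← h2]; linear_combination sinh (t + r) * h1
    have h4 : sinh (t + r) ^ 2 * (cosh (dist m n) - 1) = sinh t ^ 2 * (cosh (dist x y) - 1) := by
      linear_combination this - hsq - sinh r * e3
    rw [e1, e2] at h4
    linear_combination h4 / 2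
  have p1 : 0 ≤ sinh (t + r) * sinh (dist m n / 2) :=
    mul_nonneg (sinh_nonneg_iff.mpr (by linarith)) (sinh_nonneg_iff.mpr (by positivity))
  have p2 : 0 ≤ sinh t * sinh (dist x y / 2) :=
    mul_nonneg (sinh_nonneg_iff.mpr ht) (sinh_nonneg_iff.mpr (by positivity))
  exact (pow_left_inj₀ p1 p2 two_ne_zero).mp key

end UpperHalfPlane

/-! ### Consequences of CAT(-1) comparison. -/

/-- The `CAT(-1)` comparison in terms of the upper half-plane. -/
theorem IsCATNegOne.comparison {X : Type*} [MetricSpace X] (hX : IsCATNegOne X) (x y z : X) :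
    ∃ x' y' z' : UpperHalfPlane,
      dist x' y' = dist x y ∧ dist x' z' = dist x z ∧ dist y' z' = dist y z ∧
      ∀ (p q : X) (p' q' : UpperHalfPlane),
        dist x p + dist p y = dist x y → dist x q + dist q z = dist x z →
        dist x' p' = dist x p → dist p' y' = dist p y →
        dist x' q' = dist x q → dist q' z' = dist q z →
        dist p q ≤ dist p' q' := by
  have hd : ∀ a b : HypPlane ⟨-1, by norm_num⟩, dist a b = dist a.toUpper b.toUpper := by
    intro a b
    change dist a.toUpper b.toUpper / Real.sqrt (-(-1)) = _
    simp
  obtain ⟨x', y', z', h1, h2, h3, h4⟩ := hX.2 x y z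
  simp only [hd] at h1 h2 h3 h4
  exact ⟨x', y', z', h1, h2, h3, h4⟩

open Real in
theorem IsCATNegOne.isosceles {X : Type*} [MetricSpace X] (hX : IsCATNegOne X) {x y z p q : X}
    {t r : ℝ} (hp : dist x p = t) (hp' : dist p y = r) (hq : dist x q = t) (hq' : dist q z = r)
    (hy : dist x y = t + r) (hz : dist x z = t + r) :
    sinh (t + r) * sinh (dist p q / 2) ≤ sinh t * sinh (dist y z / 2) := by
  have ht : 0 ≤ t := hp ▸ dist_nonneg
  have hr : 0 ≤ r := hp' ▸ dist_nonneg
  obtain ⟨x', y', z', h1, h2, h3, h4⟩ := hX.comparison x y z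
  obtain ⟨p', hp1, hp2⟩ := UpperHalfPlane.exists_between x' y' ht hr (by rw [h1, hy])
  obtain ⟨q', hq1, hq2⟩ := UpperHalfPlane.exists_between x' z' ht hr (by rw [h2, hz])
  have h := h4 p q p' q' (by rw [hp, hp', hy]) (by rw [hq, hq', hz]) (by rw [hp1, hp])
    (by rw [hp2, hp']) (by rw [hq1, hq]) (by rw [hq2, hq'])
  rw [← h3, ← UpperHalfPlane.isosceles hp1 hp2 hq1 hq2 (by rw [h1, hy]) (by rw [h2, hz])]
  exact mul_le_mul_of_nonneg_left (sinh_le_sinh.mpr (by linarith))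
    (sinh_nonneg_iff.mpr (by linarith))

open Real in
theorem IsCATNegOne.dist_le_of_isosceles {X : Type*} [MetricSpace X] (hX : IsCATNegOne X)
    {x y z p q : X} {t r : ℝ} (hp : dist x p = t) (hp' : dist p y = r) (hq : dist x q = t)
    (hq' : dist q z = r) (hy : dist x y = t + r) (hz : dist x z = t + r) :
    dist p q ≤ dist y z := by
  have ht : 0 ≤ t := hp ▸ dist_nonneg
  have hr : 0 ≤ r := hp' ▸ dist_nonneg
  rcases ht.eq_or_lt with h0 | h0
  · rw [← h0] at hp hq
    rw [← dist_eq_zero.mp hp, ← dist_eq_zero.mp hq, dist_self]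
    exact dist_nonneg
  · have h := hX.isosceles hp hp' hq hq' hy hz
    have h1 : sinh t * sinh (dist y z / 2) ≤ sinh (t + r) * sinh (dist y z / 2) :=
      mul_le_mul_of_nonneg_right (sinh_le_sinh.mpr (by linarith))
        (sinh_nonneg_iff.mpr (by positivity))
    have h2 := sinh_le_sinh.mp
      (le_of_mul_le_mul_left (h.trans h1) (sinh_pos_iff.mpr (by linarith)))
    linarith

open Real in
/-- Local geodesics are geodesics. -/
theorem IsCATNegOne.dist_eq_add {X : Type*} [MetricSpace X] (hX : IsCATNegOne X) {x p q y : X}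
    (hpq : p ≠ q) (h1 : dist x p + dist p q = dist x q) (h2 : dist p q + dist q y = dist p y) :
    dist x y = dist x p + dist p q + dist q y := by
  have hm : 0 < dist p q := dist_pos.mpr hpq
  have ha : 0 ≤ dist x p := dist_nonneg
  obtain ⟨q', x', y', e1, e2, e3, h4⟩ := hX.comparison q x y
  obtain ⟨p', hp1, hp2⟩ := UpperHalfPlane.exists_between q' x' hm.le ha
    (by rw [e1, dist_comm q x]; linarith)
  have h := h4 p y p' y' (by rw [dist_comm q p, dist_comm p x, dist_comm q x]; linarith)
    (by simp) (by rw [hp1, dist_comm]) (by rw [hp2, dist_comm]) e2 (by simp)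
  have hs := UpperHalfPlane.stewart (o := q') (m := p') (x := x')
    (by rw [hp1, hp2, e1, dist_comm q x]; linarith) y'
  rw [e1, e2, e3, hp1, hp2, dist_comm q x, ← h1] at hs
  set a := dist x p
  set m := dist p q
  set c := dist q y
  refine le_antisymm ?_ ?_
  · have := dist_triangle4 x p q y
    linarith
  · have hc : cosh (m + c) ≤ cosh (dist p' y') := by
      rw [cosh_le_cosh, abs_of_nonneg (by positivity), abs_of_nonneg dist_nonneg]
      linarith
    have hle : sinh (a + m) * cosh (m + c) ≤ sinh a * cosh c + sinh m * cosh (dist x y) := by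
      rw [← hs]
      exact mul_le_mul_of_nonneg_left hc (sinh_nonneg_iff.mpr (by positivity))
    -- This is the equality case of Stewart, for a degenerate comparison triangle. It turns the
    -- bound `hle` into a lower bound for `dist x y`.
    have hid : sinh (a + m) * cosh (m + c) = sinh a * cosh c + sinh m * cosh (a + m + c) := by
      rw [cosh_add (a + m) c, sinh_add, cosh_add a m, cosh_add m c]
      have := cosh_sq m
      linear_combination (sinh a * cosh c) * this
    have h5 : cosh (a + m + c) ≤ cosh (dist x y) :=
      le_of_mul_le_mul_left (by linarith) (sinh_pos_iff.mpr hm)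
    rw [cosh_le_cosh, abs_of_nonneg (by positivity), abs_of_nonneg dist_nonneg] at h5
    exact h5

/-! ### Properness from cocompactness. -/

/-- Hopf-Rinow for cocompact spaces. -/
theorem ActsCocompactly.properSpace {G X : Type*} [Group G] [MetricSpace X] [MulAction G X]
    [IsIsometricSMul G X] [LocallyCompactSpace X] (hG : ActsCocompactly G X)
    (hX : IsGeodesicSpace X) : ProperSpace X := by
  obtain ⟨C, hC, hcov⟩ := hG
  obtain ⟨δ, hδ, hδC⟩ := hC.exists_isCompact_cthickening
  have hball : ∀ x : X, IsCompact (Metric.closedBall x δ) := by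
    intro x
    obtain ⟨g, y, hy, rfl⟩ := hcov x
    have h1 : IsCompact (Metric.closedBall y δ) :=
      hδC.of_isClosed_subset Metric.isClosed_closedBall (Metric.closedBall_subset_cthickening hy δ)
    have h2 := h1.image (isometry_smul X g).continuous
    refine h2.of_isClosed_subset Metric.isClosed_closedBall fun z hz => ⟨g⁻¹ • z, ?_, by simp⟩
    rw [Metric.mem_closedBall] at hz ⊢
    rw [← dist_smul g]
    simpa using hz
  -- The radius grows by `δ / 2` per step: a point of the larger ball is within `δ / 2` of the
  -- smaller ball along a geodesic, hence within `δ` of one of finitely many centres.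
  have hn : ∀ (n : ℕ) (x : X), IsCompact (Metric.closedBall x (n * (δ / 2))) := by
    intro n x
    induction n with
    | zero => simp
    | succ n ih =>
      obtain ⟨t, -, htf, ht⟩ := ih.finite_cover_balls (half_pos hδ)
      refine (htf.isCompact_biUnion fun y _ => hball y).of_isClosed_subset
        Metric.isClosed_closedBall fun z hz => ?_
      rw [Metric.mem_closedBall'] at hz
      push_cast at hz
      obtain ⟨c, hc0, hc1, hc⟩ := hX x z
      set s := max 0 (dist x z - δ / 2) with hs
      have hs0 : 0 ≤ s := le_max_left _ _
      have hs1 : s ≤ dist x z := max_le dist_nonneg (by linarith)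
      have hs2 : dist x z - δ / 2 ≤ s := le_max_right _ _
      have h1 : dist x (c s) = s := by
        conv_lhs => rw [← hc0]
        rw [hc 0 ⟨le_rfl, dist_nonneg⟩ s ⟨hs0, hs1⟩, zero_sub, abs_neg, abs_of_nonneg hs0]
      have h2 : dist (c s) z = dist x z - s := by
        conv_lhs => rw [← hc1]
        rw [hc s ⟨hs0, hs1⟩ _ ⟨dist_nonneg, le_rfl⟩, abs_sub_comm, abs_of_nonneg (by linarith)]
      have h3 : c s ∈ Metric.closedBall x (n * (δ / 2)) := by
        rw [Metric.mem_closedBall', h1]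
        exact max_le (by positivity) (by linarith)
      obtain ⟨y, hy, hy'⟩ := Set.mem_iUnion₂.mp (ht h3)
      refine Set.mem_iUnion₂.mpr ⟨y, hy, ?_⟩
      rw [Metric.mem_ball] at hy'
      rw [Metric.mem_closedBall]
      have := dist_triangle z (c s) y
      rw [dist_comm z (c s)] at this
      linarith
  refine ⟨fun x r => ?_⟩
  obtain ⟨n, hnr⟩ := exists_nat_ge (r / (δ / 2))
  rw [div_le_iff₀ (half_pos hδ)] at hnr
  exact (hn n x).of_isClosed_subset Metric.isClosed_closedBall
    (Metric.closedBall_subset_closedBall hnr)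

/-! ### Geodesic rays: divergence, uniqueness, existence. -/

namespace GeodesicRay

variable {X : Type*} [MetricSpace X]

theorem dist_eq (f : GeodesicRay X) (s t : ℝ≥0) : dist (f s) (f t) = |(s : ℝ) - t| := by
  rw [f.isometry.dist_eq, NNReal.dist_eq]

theorem dist_eq_sub (f : GeodesicRay X) {s t : ℝ≥0} (h : s ≤ t) :
    dist (f s) (f t) = (t : ℝ) - s := by
  have : (s : ℝ) ≤ t := h
  rw [f.dist_eq, abs_sub_comm, abs_of_nonneg (by linarith)]

theorem dist_zero (f : GeodesicRay X) (t : ℝ≥0) : dist (f 0) (f t) = t := by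
  rw [f.dist_eq_sub zero_le]; simp

/-- The ray `t ↦ f (u + t)`. -/
def shift (f : GeodesicRay X) (u : ℝ≥0) : GeodesicRay X where
  toFun t := f (u + t)
  isometry := f.isometry.comp (Isometry.of_dist_eq fun s t => by simp [NNReal.dist_eq])

@[simp] theorem shift_apply (f : GeodesicRay X) (u t : ℝ≥0) : f.shift u t = f (u + t) := rfl

theorem endpoint_eq_iff {f g : GeodesicRay X} :
    f.endpoint = g.endpoint ↔ ∃ C : ℝ, ∀ t, dist (f t) (g t) ≤ C := Quotient.eq

open Real in
-- The chord law as an inequality: it carries information at infinity (large `n`) back to the vertex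
-- (small `t`).
theorem isosceles (hX : IsCATNegOne X) {f g : GeodesicRay X} (h0 : f 0 = g 0) {t n : ℝ≥0}
    (h : t ≤ n) :
    sinh n * sinh (dist (f t) (g t) / 2) ≤ sinh t * sinh (dist (f n) (g n) / 2) := by
  have hn : (t : ℝ) + (n - t) = n := by ring
  have := hX.isosceles (x := f 0) (p := f t) (q := g t) (y := f n) (z := g n) (f.dist_zero t)
    (f.dist_eq_sub h) (by rw [h0, g.dist_zero]) (g.dist_eq_sub h)
    (by rw [f.dist_zero, hn]) (by rw [h0, g.dist_zero, hn])
  rwa [hn] at this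

open Real in
-- Equality holds in the model plane, so there information near the vertex also propagates out to
-- infinity.
theorem hypPlane_isosceles {K : Set.Iio (0 : ℝ)} {f g : GeodesicRay (HypPlane K)} (h0 : f 0 = g 0)
    {t n : ℝ≥0} (h : t ≤ n) :
    sinh (√(-(K : ℝ)) * n) * sinh (√(-(K : ℝ)) * dist (f t) (g t) / 2) =
      sinh (√(-(K : ℝ)) * t) * sinh (√(-(K : ℝ)) * dist (f n) (g n) / 2) := by
  set κ := √(-(K : ℝ)) with hκ
  have hκ0 : κ ≠ 0 := (HypPlane.sqrt_neg_pos K).ne'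
  have hd : ∀ a b : HypPlane K, dist a.toUpper b.toUpper = κ * dist a b := by
    intro a b
    change _ = κ * (dist a.toUpper b.toUpper / κ)
    field_simp
  have hn : κ * (t : ℝ) + κ * (n - t) = κ * n := by ring
  have := UpperHalfPlane.isosceles (o := (f 0).toUpper) (m := (f t).toUpper) (n := (g t).toUpper)
    (x := (f n).toUpper) (y := (g n).toUpper) (t := κ * t) (r := κ * (n - t))
    (by rw [hd, f.dist_zero]) (by rw [hd, f.dist_eq_sub h]) (by rw [hd, h0, g.dist_zero])
    (by rw [hd, g.dist_eq_sub h]) (by rw [hd, f.dist_zero, hn]) (by rw [hd, h0, g.dist_zero, hn])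
  rwa [hn, hd, hd] at this

open Real in
/-- Asymptotic rays with the same origin coincide. -/
theorem eq_of_asymptotic (hX : IsCATNegOne X) {f g : GeodesicRay X} (h0 : f 0 = g 0)
    (h : f.endpoint = g.endpoint) (t : ℝ≥0) : f t = g t := by
  obtain ⟨C, hC⟩ := endpoint_eq_iff.mp h
  by_contra hne
  have hpos : 0 < sinh (dist (f t) (g t) / 2) :=
    sinh_pos_iff.mpr (half_pos (dist_pos.mpr hne))
  set δ := sinh (dist (f t) (g t) / 2)
  -- If the rays differed at `t`, the left side of the chord law would grow at least linearly in
  -- `m`, while asymptoticity bounds the right side.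
  obtain ⟨m, hm⟩ := exists_nat_gt (sinh t * sinh (C / 2) / δ)
  rw [div_lt_iff₀ hpos] at hm
  have h1 := isosceles hX h0 (t := t) (n := t + m) le_self_add
  have h2 : sinh (dist (f (t + m)) (g (t + m)) / 2) ≤ sinh (C / 2) :=
    sinh_le_sinh.mpr (by linarith [hC (t + m)])
  have h3 : (m : ℝ) ≤ sinh ((t + m : ℝ≥0) : ℝ) := by
    have h4 : (0 : ℝ) ≤ ((t + m : ℝ≥0) : ℝ) := NNReal.coe_nonneg _
    have h5 := self_le_sinh_iff.mpr h4
    push_cast at h5 ⊢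
    linarith [t.coe_nonneg]
  have h6 : sinh (t : ℝ) * sinh (dist (f (t + m)) (g (t + m)) / 2) ≤ sinh t * sinh (C / 2) :=
    mul_le_mul_of_nonneg_left h2 (sinh_nonneg_iff.mpr t.coe_nonneg)
  have h7 : (m : ℝ) * δ ≤ sinh ((t + m : ℝ≥0) : ℝ) * δ := mul_le_mul_of_nonneg_right h3 hpos.le
  linarith

end GeodesicRay

/-- A pointwise limit of longer and longer geodesic segments with a common origin. -/
theorem exists_ray_of_segments {X : Type*} [MetricSpace X] [ProperSpace X] (b : X)
    (c : ℕ → ℝ → X) (ℓ : ℕ → ℝ) (hℓ : Tendsto ℓ atTop atTop) (h0 : ∀ n, c n 0 = b)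
    (hc : ∀ n, ∀ s ∈ Set.Icc 0 (ℓ n), ∀ t ∈ Set.Icc 0 (ℓ n), dist (c n s) (c n t) = |s - t|) :
    ∃ h : GeodesicRay X, h 0 = b ∧ ∀ (t : ℝ≥0) (y : X) (D : ℝ),
      (∀ᶠ n in atTop, dist (c n t) y ≤ D) → dist (h t) y ≤ D := by
  -- Limits along one fixed ultrafilter exist for all `t` simultaneously, in place of a diagonal
  -- subsequence.
  have hle : (hyperfilter ℕ : Filter ℕ) ≤ atTop := Nat.hyperfilter_le_atTop
  have hlim : ∀ t : ℝ≥0, ∃ y, Tendsto (fun n => c n t) (hyperfilter ℕ) (𝓝 y) := by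
    intro t
    have hmem : ∀ᶠ n in atTop, c n t ∈ Metric.closedBall b t := by
      filter_upwards [hℓ.eventually_ge_atTop (t : ℝ)] with n hn
      rw [Metric.mem_closedBall', ← h0 n,
        hc n 0 ⟨le_rfl, t.coe_nonneg.trans hn⟩ t ⟨t.coe_nonneg, hn⟩, zero_sub, abs_neg,
        abs_of_nonneg t.coe_nonneg]
    obtain ⟨y, -, hy⟩ := (isCompact_closedBall b (t : ℝ)).ultrafilter_le_nhds
      ((hyperfilter ℕ).map fun n => c n t) (le_principal_iff.mpr (hle hmem))
    exact ⟨y, hy⟩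
  choose h hh using hlim
  refine ⟨⟨h, Isometry.of_dist_eq fun s t => ?_⟩, ?_, fun t y D hD => ?_⟩
  · refine tendsto_nhds_unique ((hh s).dist (hh t)) (tendsto_const_nhds.congr' ?_)
    refine hle ?_
    filter_upwards [hℓ.eventually_ge_atTop (s : ℝ), hℓ.eventually_ge_atTop (t : ℝ)] with n h1 h2
    rw [hc n s ⟨s.coe_nonneg, h1⟩ t ⟨t.coe_nonneg, h2⟩, NNReal.dist_eq]
  · refine tendsto_nhds_unique (hh 0) (tendsto_const_nhds.congr fun n => ?_)
    rw [NNReal.coe_zero, h0]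
  · exact le_of_tendsto ((hh t).dist tendsto_const_nhds) (hle hD)

/-- Every point is joined to every ideal point by a ray. -/
theorem GeodesicRay.exists_asymptotic {X : Type*} [MetricSpace X] [ProperSpace X]
    (hX : IsCATNegOne X) (F : GeodesicRay X) (b : X) :
    ∃ h : GeodesicRay X, h 0 = b ∧ ∀ t, dist (h t) (F t) ≤ 3 * dist b (F 0) := by
  set D := dist b (F 0)
  choose c hc0 hc1 hc using fun n : ℕ => hX.1 b (F n)
  have hub : ∀ n : ℕ, dist b (F n) ≤ D + n := fun n => by
    have := dist_triangle b (F 0) (F n)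
    rwa [F.dist_zero, NNReal.coe_natCast] at this
  have hlb : ∀ n : ℕ, (n : ℝ) - D ≤ dist b (F n) := fun n => by
    have := dist_triangle_left (F 0) (F n) b
    rw [F.dist_zero, NNReal.coe_natCast] at this
    linarith
  have hℓ : Tendsto (fun n : ℕ => dist b (F n)) atTop atTop :=
    tendsto_atTop_mono hlb (tendsto_atTop_add_const_right _ _ tendsto_natCast_atTop_atTop)
  obtain ⟨h, h0, hlim⟩ := exists_ray_of_segments b c _ hℓ hc0 hc
  refine ⟨h, h0, fun t => hlim t _ _ ?_⟩
  filter_upwards [hℓ.eventually_ge_atTop (t : ℝ), eventually_ge_atTop ⌈(t : ℝ)⌉₊] with n hn hn'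
  have htn : (t : ℝ) ≤ n := (Nat.le_ceil _).trans (Nat.cast_le.mpr hn')
  have ht := t.coe_nonneg
  have hcend : ∀ s, 0 ≤ s → s ≤ dist b (F n) → dist (F n) (c n s) = dist b (F n) - s := by
    intro s hs hs'
    conv_lhs => rw [← hc1 n]
    rw [hc n _ ⟨dist_nonneg, le_rfl⟩ s ⟨hs, hs'⟩, abs_of_nonneg (by linarith)]
  have hFend : ∀ s : ℝ≥0, (s : ℝ) ≤ n → dist (F n) (F s) = n - s := by
    intro s hs
    rw [F.dist_eq, NNReal.coe_natCast, abs_of_nonneg (by linarith)]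
  set L := dist b (F n)
  have hL1 := hub n
  have hL2 := hlb n
  -- The longer of the two sides at the apex `F n` is cut to the length of the shorter. The cut is
  -- at most `D` and enters twice, whence the factor 3.
  rcases le_total L n with hLn | hLn
  · set u : ℝ≥0 := ⟨n - L, by linarith⟩ with hu
    have hu' : (u : ℝ) = n - L := rfl
    have key := hX.dist_le_of_isosceles (x := F n) (p := c n t) (y := b) (q := F (u + t))
      (z := F u) (t := L - t) (r := t) (hcend t ht hn)
      (by rw [← hc0 n, hc n t ⟨ht, hn⟩ 0 ⟨le_rfl, dist_nonneg⟩, sub_zero, abs_of_nonneg ht])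
      (by rw [hFend _ (by push_cast; linarith)]; push_cast; linarith)
      (by rw [F.dist_eq]; push_cast; rw [add_sub_cancel_left, abs_of_nonneg ht])
      (by rw [dist_comm]; ring) (by rw [hFend u (by linarith)]; linarith)
    have h1 := dist_triangle b (F 0) (F u)
    rw [F.dist_zero] at h1
    have h2 := dist_triangle (c n t) (F (u + t)) (F t)
    have h3 : dist (F (u + t)) (F t) = u := by
      rw [F.dist_eq]; push_cast; rw [add_sub_cancel_right, abs_of_nonneg u.coe_nonneg]
    linarith
  · set v : ℝ := L - n with hv
    have hv0 : 0 ≤ v := by linarith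
    have key := hX.dist_le_of_isosceles (x := F n) (p := c n (v + t)) (y := c n v) (q := F t)
      (z := F 0) (t := n - t) (r := t)
      (by rw [hcend _ (by linarith) (by linarith)]; linarith)
      (by rw [hc n _ ⟨by linarith, by linarith⟩ _ ⟨hv0, by linarith⟩, add_sub_cancel_left,
            abs_of_nonneg ht])
      (hFend t htn) (by rw [dist_comm, F.dist_zero])
      (by rw [hcend v hv0 (by linarith)]; linarith)
      (by rw [hFend 0 (by simp)]; simp)
    have h1 : dist (c n v) b = v := by
      conv_lhs => rw [← hc0 n]
      rw [hc n v ⟨hv0, by linarith⟩ 0 ⟨le_rfl, dist_nonneg⟩, sub_zero, abs_of_nonneg hv0]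
    have h2 : dist (c n t) (c n (v + t)) = v := by
      rw [hc n t ⟨ht, hn⟩ _ ⟨by linarith, by linarith⟩, abs_sub_comm, add_sub_cancel_right,
        abs_of_nonneg hv0]
    have h3 := dist_triangle (c n v) b (F 0)
    have h4 := dist_triangle (c n t) (c n (v + t)) (F t)
    linarith

/-! ### Geodesic lines and extension of rays. -/

/-- Two rays from a point `p` form a line as soon as one of them extends a segment of the other. -/
theorem IsCATNegOne.exists_line {X : Type*} [MetricSpace X] (hX : IsCATNegOne X)
    {f k : GeodesicRay X} (h0 : f 0 = k 0) (h1 : ∀ s, dist (k s) (f 1) = s + 1) :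
    ∃ γ : GeodesicLine X, γ.forward = f ∧ γ.backward = k := by
  have hmain : ∀ s t : ℝ≥0, dist (k s) (f t) = s + t := by
    intro s t
    have hks : dist (k s) (f 0) = s := by rw [h0, dist_comm, k.dist_zero]
    have h01 : dist (f 0) (f 1) = 1 := by rw [f.dist_zero]; simp
    -- For `t ≥ 1` the geodesics overlap in the segment from `f 0` to `f 1`, so `dist_eq_add`
    -- applies; for `t ≤ 1` the triangle inequality suffices.
    rcases le_total 1 t with ht | ht
    · have h1t := f.dist_eq_sub ht
      rw [hX.dist_eq_add (p := f 0) (q := f 1) (fun h => by simp [h] at h01)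
        (by rw [hks, h01, h1]) (by rw [h01, h1t, f.dist_zero]; simp), hks, h01, h1t]
      push_cast; ring
    · have h1t := f.dist_eq_sub ht
      have h2 := dist_triangle (k s) (f t) (f 1)
      have h3 := dist_triangle (k s) (f 0) (f t)
      rw [h1, h1t] at h2
      rw [hks, f.dist_zero] at h3
      push_cast at h2
      linarith
  let c : ℝ → X := fun t => if 0 ≤ t then f t.toNNReal else k (-t).toNNReal
  have hcp : ∀ t, 0 ≤ t → c t = f t.toNNReal := fun t ht => if_pos ht
  have hcn : ∀ t, t ≤ 0 → c t = k (-t).toNNReal := by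
    intro t ht
    rcases ht.eq_or_lt with rfl | h
    · simp [c, h0]
    · exact if_neg h.not_ge
  have hiso : Isometry c := by
    refine Isometry.of_dist_eq fun s t => ?_
    rw [Real.dist_eq]
    rcases le_total 0 s with hs | hs <;> rcases le_total 0 t with ht | ht
    · rw [hcp s hs, hcp t ht, f.dist_eq, Real.coe_toNNReal _ hs, Real.coe_toNNReal _ ht]
    · rw [hcp s hs, hcn t ht, dist_comm, hmain, Real.coe_toNNReal _ hs,
        Real.coe_toNNReal _ (by linarith), abs_of_nonneg (by linarith)]
      ring
    · rw [hcn s hs, hcp t ht, hmain, Real.coe_toNNReal _ (by linarith),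
        Real.coe_toNNReal _ ht, abs_of_nonpos (by linarith)]
      ring
    · rw [hcn s hs, hcn t ht, k.dist_eq, Real.coe_toNNReal _ (by linarith),
        Real.coe_toNNReal _ (by linarith), abs_sub_comm]
      congr 1
      ring
  refine ⟨⟨c, hiso⟩, ?_, ?_⟩
  · cases f with | mk φ hφ =>
    simp only [GeodesicLine.forward, GeodesicRay.mk.injEq]
    funext t
    rw [hcp _ t.coe_nonneg, Real.toNNReal_coe]
  · cases k with | mk φ hφ =>
    simp only [GeodesicLine.backward, GeodesicRay.mk.injEq]
    funext t
    rw [hcn _ (by simp), neg_neg, Real.toNNReal_coe]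

namespace GeodesicLine

variable {X : Type*} [MetricSpace X]

theorem dist_eq (γ : GeodesicLine X) (s t : ℝ) : dist (γ s) (γ t) = |s - t| := by
  rw [γ.isometry.dist_eq, Real.dist_eq]

/-- The ray `t ↦ γ (a - t)`. -/
def ray (γ : GeodesicLine X) (a : ℝ) : GeodesicRay X where
  toFun t := γ (a - t)
  isometry := Isometry.of_dist_eq fun s t => by
    rw [γ.dist_eq, NNReal.dist_eq, abs_sub_comm]
    congr 1
    ring

@[simp] theorem ray_apply (γ : GeodesicLine X) (a : ℝ) (t : ℝ≥0) : γ.ray a t = γ (a - t) := rfl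

theorem forward_apply (γ : GeodesicLine X) (t : ℝ≥0) : γ.forward t = γ t := rfl

theorem backward_apply (γ : GeodesicLine X) (t : ℝ≥0) : γ.backward t = γ (-t) := rfl

end GeodesicLine

/-- Every ray extends to a line. -/
theorem GeodesicRay.exists_extension {X : Type*} [MetricSpace X] (hX : IsCATNegOne X)
    (hext : HasGeodesicExtension X) (f : GeodesicRay X) :
    ∃ γ : GeodesicLine X, γ.forward = f := by
  have h01 : dist (f 0) (f 1) = 1 := by rw [f.dist_zero]; simp
  -- Only the initial unit segment is extended; the backward half of that line is then glued to `f`.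
  obtain ⟨γ, h0, h1⟩ := hext (f 0) (f 1) fun h => by simp [h] at h01
  rw [h01] at h1
  obtain ⟨γ', h, -⟩ := hX.exists_line (f := f) (k := γ.backward)
    (by rw [γ.backward_apply]; simp [h0]) fun s => by
      rw [γ.backward_apply, ← h1, γ.dist_eq, abs_of_nonpos (by linarith [s.coe_nonneg])]
      ring
  exact ⟨γ', h⟩

/-! ### Gromov products versus closeness near the origin. -/

theorem sinh_le_mul_exp (x : ℝ) : Real.sinh x ≤ x * Real.exp x := by
  rw [Real.sinh_eq]
  have h1 := Real.add_one_le_exp (-(2 * x))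
  have h2 : Real.exp (-x) = Real.exp (-(2 * x)) * Real.exp x := by rw [← Real.exp_add]; ring_nf
  rw [h2]
  nlinarith [Real.exp_pos x]

theorem exp_le_two_mul_sinh_add_one {x : ℝ} (hx : 0 ≤ x) : Real.exp x ≤ 2 * Real.sinh x + 1 := by
  rw [Real.sinh_eq]
  have : Real.exp (-x) ≤ 1 := Real.exp_le_one_iff.mpr (by linarith)
  linarith

theorem two_mul_sinh_le_exp (x : ℝ) : 2 * Real.sinh x ≤ Real.exp x := by
  rw [Real.sinh_eq]
  linarith [Real.exp_pos (-x)]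

theorem exp_le_four_mul_sinh {x : ℝ} (hx : 1 ≤ x) : Real.exp x ≤ 4 * Real.sinh x := by
  rw [Real.sinh_eq]
  have h1 : Real.exp (-x) ≤ 1 := Real.exp_le_one_iff.mpr (by linarith)
  have h2 := Real.add_one_le_exp x
  linarith

namespace GeodesicRay

variable {X : Type*} [MetricSpace X]

theorem gromovProduct_eq {f g : GeodesicRay X} (h0 : f 0 = g 0) (s t : ℝ≥0) :
    gromovProduct (f 0) (f s) (g t) = (s + t - dist (f s) (g t)) / 2 := by
  rw [gromovProduct, dist_comm (f s), f.dist_zero, dist_comm (g t), h0, g.dist_zero]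

theorem le_rayGromovProduct {f g : GeodesicRay X} (h0 : f 0 = g 0) {c : ℝ} (N : ℝ≥0)
    (h : ∀ s t : ℝ≥0, N ≤ s → N ≤ t → c ≤ (s + t - dist (f s) (g t)) / 2) :
    (c : EReal) ≤ rayGromovProduct f g := by
  refine le_liminf_of_le (by isBoundedDefault) ?_
  filter_upwards [eventually_ge_atTop (N, N)] with r hr
  rw [gromovProduct_eq h0, EReal.coe_le_coe_iff]
  exact h _ _ hr.1 hr.2

theorem exists_lt_gromovProduct {f g : GeodesicRay X} (h0 : f 0 = g 0) {c : ℝ}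
    (h : (c : EReal) < rayGromovProduct f g) :
    ∃ N : ℝ≥0, ∀ s t : ℝ≥0, N ≤ s → N ≤ t → c < (s + t - dist (f s) (g t)) / 2 := by
  obtain ⟨⟨a, b⟩, hab⟩ := eventually_atTop.mp (eventually_lt_of_lt_liminf h)
  refine ⟨max a b, fun s t hs ht => ?_⟩
  have := hab (s, t) ⟨(le_max_left _ _).trans hs, (le_max_right _ _).trans ht⟩
  rwa [EReal.coe_lt_coe_iff, gromovProduct_eq h0] at this

theorem rayGromovProduct_nonneg {f g : GeodesicRay X} (h0 : f 0 = g 0) :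
    0 ≤ rayGromovProduct f g := by
  refine le_rayGromovProduct h0 0 fun s t _ _ => ?_
  have := dist_triangle_left (f s) (g t) (f 0)
  rw [f.dist_zero, h0, g.dist_zero] at this
  linarith

theorem rayGromovProduct_eq_top {f g : GeodesicRay X} (h0 : f 0 = g 0)
    (h : f.endpoint = g.endpoint) : rayGromovProduct f g = ⊤ := by
  obtain ⟨D, hD⟩ := endpoint_eq_iff.mp h
  refine EReal.eq_top_iff_forall_lt _ |>.mpr fun c => ?_
  refine (EReal.coe_lt_coe_iff.mpr (lt_add_one c)).trans_le
    (le_rayGromovProduct h0 (c + 1 + D).toNNReal fun s t hs ht => ?_)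
  have h1 := (Real.le_coe_toNNReal (c + 1 + D)).trans (NNReal.coe_le_coe.mpr hs)
  have h2 := (Real.le_coe_toNNReal (c + 1 + D)).trans (NNReal.coe_le_coe.mpr ht)
  have h3 := dist_triangle (f s) (f t) (g t)
  have h4 := hD t
  have h5 := dist_nonneg.trans h4
  rw [f.dist_eq] at h3
  rcases abs_cases ((s : ℝ) - t) with h6 | h6 <;> linarith

/-- A bound from below on the product gives closeness near the origin, in a `CAT(-1)` space. -/
theorem dist_le_of_lt_rayGromovProduct (hX : IsCATNegOne X) {f g : GeodesicRay X} (h0 : f 0 = g 0)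
    {A : ℝ} (h : (A : EReal) < rayGromovProduct f g) {t : ℝ≥0} (ht : t ≤ 1) :
    dist (f t) (g t) ≤ 12 * t * Real.exp (-A) := by
  obtain ⟨N, hN⟩ := exists_lt_gromovProduct h0 h
  -- `n ≥ 1` gives both `t ≤ n` and `exp n ≤ 4 sinh n`; with `sinh t ≤ 3 t` this produces the
  -- constant 12.
  set n := max N 1
  have hn1 : (1 : ℝ) ≤ n := NNReal.coe_le_coe.mpr (le_max_right N 1)
  have hd := hN n n (le_max_left _ _) (le_max_left _ _)
  have h1 := isosceles hX h0 (ht.trans (le_max_right N 1))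
  have h2 : Real.sinh (dist (f n) (g n) / 2) ≤ Real.exp (n - A) / 2 := by
    have := two_mul_sinh_le_exp (dist (f n) (g n) / 2)
    have h3 : Real.exp (dist (f n) (g n) / 2) ≤ Real.exp (n - A) :=
      Real.exp_le_exp.mpr (by linarith)
    linarith
  have ht0 := t.coe_nonneg
  have h4 : Real.sinh t ≤ 3 * t := by
    have h5 : Real.exp (t : ℝ) ≤ Real.exp 1 := Real.exp_le_exp.mpr (NNReal.coe_le_coe.mpr ht)
    nlinarith [sinh_le_mul_exp t, Real.exp_one_lt_d9]
  have h5 := exp_le_four_mul_sinh hn1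
  have h6 : dist (f t) (g t) / 2 ≤ Real.sinh (dist (f t) (g t) / 2) :=
    Real.self_le_sinh_iff.mpr (by positivity)
  have h7 : Real.sinh n * Real.sinh (dist (f t) (g t) / 2) ≤ 3 * t * (Real.exp (n - A) / 2) :=
    h1.trans (mul_le_mul h4 h2 (Real.sinh_nonneg_iff.mpr (by positivity)) (by positivity))
  have h8 : Real.exp n / 4 * (dist (f t) (g t) / 2) ≤ 3 * t * (Real.exp (n - A) / 2) :=
    le_trans (mul_le_mul (by linarith) h6 (by positivity)
      (Real.sinh_nonneg_iff.mpr (by linarith))) h7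
  rw [sub_eq_add_neg, Real.exp_add] at h8
  have h9 : Real.exp n * dist (f t) (g t) ≤ Real.exp n * (12 * t * Real.exp (-A)) := by linarith
  exact le_of_mul_le_mul_left h9 (Real.exp_pos _)

/-- Closeness near the origin gives a bound from below on the product, in a plane of constant
curvature. -/
theorem le_rayGromovProduct_hypPlane (K : Set.Iio (0 : ℝ)) {M : ℝ} (hM : 0 ≤ M) :
    ∃ C : ℝ, 0 ≤ C ∧ ∀ f g : GeodesicRay (HypPlane K), f 0 = g 0 →
      ∀ (ℓ : ℝ≥0) (A : ℝ), 0 < ℓ → ℓ ≤ 1 → 0 ≤ A → dist (f ℓ) (g ℓ) ≤ M * ℓ * Real.exp (-A) →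
      ((A / √(-(K : ℝ)) - C : ℝ) : EReal) ≤ rayGromovProduct f g := by
  have hκ := HypPlane.sqrt_neg_pos K
  set κ := √(-(K : ℝ)) with hκdef
  set B := M * Real.exp (κ * M) with hB
  have hB0 : 0 ≤ B := by positivity
  refine ⟨Real.log (B + 1) / κ, div_nonneg (Real.log_nonneg (by linarith)) hκ.le, ?_⟩
  intro f g h0 ℓ A hℓ hℓ1 hA hd
  -- `N ≥ 1` puts `ℓ` below `N`; `κ N ≥ A` makes `exp (κ N - A) ≥ 1`, which absorbs the additive 1
  -- in `exp y ≤ 2 sinh y + 1`.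
  set N : ℝ≥0 := max 1 (A / κ).toNNReal
  have hN1 : 1 ≤ N := le_max_left _ _
  have hNA : A ≤ κ * N := by
    have h1 : A / κ ≤ N := (Real.le_coe_toNNReal _).trans (NNReal.coe_le_coe.mpr (le_max_right _ _))
    rwa [div_le_iff₀' hκ] at h1
  have hiso := hypPlane_isosceles h0 (hℓ1.trans hN1)
  rw [← hκdef] at hiso
  have hℓ0 : (0 : ℝ) < ℓ := hℓ
  have hℓ1' : (ℓ : ℝ) ≤ 1 := hℓ1
  have hexpA : Real.exp (-A) ≤ 1 := Real.exp_le_one_iff.mpr (by linarith)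
  set x := κ * dist (f ℓ) (g ℓ) / 2 with hx
  have hx0 : 0 ≤ x := by positivity
  have hx1 : x ≤ κ * (M * ℓ * Real.exp (-A)) := by
    have : κ * dist (f ℓ) (g ℓ) ≤ κ * (M * ℓ * Real.exp (-A)) := mul_le_mul_of_nonneg_left hd hκ.le
    have h2 : 0 ≤ κ * dist (f ℓ) (g ℓ) := by positivity
    linarith
  have hx2 : x ≤ κ * M := by
    refine hx1.trans (mul_le_mul_of_nonneg_left ?_ hκ.le)
    calc M * ℓ * Real.exp (-A) ≤ M * 1 * 1 := by gcongr
      _ = M := by ring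
  have hsx : Real.sinh x ≤ (κ * ℓ) * (B * Real.exp (-A)) := by
    calc Real.sinh x ≤ x * Real.exp x := sinh_le_mul_exp x
      _ ≤ (κ * (M * ℓ * Real.exp (-A))) * Real.exp (κ * M) := by gcongr
      _ = _ := by rw [hB]; ring
  set y := κ * dist (f N) (g N) / 2 with hy
  have hy0 : 0 ≤ y := by positivity
  have hκℓ : 0 < κ * ℓ := by positivity
  have hsy : Real.sinh y ≤ Real.sinh (κ * N) * (B * Real.exp (-A)) := by
    have h1 : κ * ℓ ≤ Real.sinh (κ * ℓ) := Real.self_le_sinh_iff.mpr hκℓ.le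
    have h2 : 0 ≤ Real.sinh y := Real.sinh_nonneg_iff.mpr hy0
    have h3 : 0 ≤ Real.sinh (κ * N) := Real.sinh_nonneg_iff.mpr (by positivity)
    -- The factor `ℓ` in the hypothesis cancels against `sinh (κ ℓ) ≥ κ ℓ`, so the bound is uniform
    -- as `ℓ → 0`.
    have h4 : κ * ℓ * Real.sinh y ≤ κ * ℓ * (Real.sinh (κ * N) * (B * Real.exp (-A))) := by
      calc κ * ℓ * Real.sinh y ≤ Real.sinh (κ * ℓ) * Real.sinh y := by gcongr
        _ = Real.sinh (κ * N) * Real.sinh x := hiso.symm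
        _ ≤ Real.sinh (κ * N) * ((κ * ℓ) * (B * Real.exp (-A))) := by gcongr
        _ = _ := by ring
    exact le_of_mul_le_mul_left h4 hκℓ
  have hexp : Real.exp y ≤ (B + 1) * Real.exp (κ * N - A) := by
    have h1 := exp_le_two_mul_sinh_add_one hy0
    have h2 : 2 * Real.sinh (κ * N) * (B * Real.exp (-A)) ≤
        Real.exp (κ * N) * (B * Real.exp (-A)) :=
      mul_le_mul_of_nonneg_right (two_mul_sinh_le_exp _) (by positivity)
    have h3 : 1 ≤ Real.exp (κ * N - A) := Real.one_le_exp (by linarith)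
    have h4 : Real.exp (κ * N - A) = Real.exp (κ * N) * Real.exp (-A) := by
      rw [sub_eq_add_neg, Real.exp_add]
    rw [h4] at h3 ⊢
    linarith
  have hlog : y ≤ Real.log (B + 1) + (κ * N - A) := by
    rw [← Real.log_exp (κ * N - A), ← Real.log_mul (by positivity) (Real.exp_pos _).ne',
      Real.le_log_iff_exp_le (by positivity)]
    exact hexp
  have hfin : A / κ - Real.log (B + 1) / κ ≤ N - dist (f N) (g N) / 2 := by
    rw [← sub_div, div_le_iff₀ hκ]
    have : (N - dist (f N) (g N) / 2) * κ = κ * N - y := by rw [hy]; ring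
    linarith
  refine le_rayGromovProduct h0 N fun s t hs ht => hfin.trans ?_
  have h1 := dist_triangle4 (f s) (f N) (g N) (g t)
  rw [dist_comm (f s) (f N), f.dist_eq_sub hs, g.dist_eq_sub ht] at h1
  linarith

end GeodesicRay

/-! ### Separation of rays and the fat triangle. -/

/-- Rays that agree at time `0` but not at time `1` separate at some intermediate time. -/
theorem GeodesicRay.exists_separation {X : Type*} [MetricSpace X] {h k : GeodesicRay X}
    (h0 : h 0 = k 0) (h1 : h 1 ≠ k 1) :
    ∃ u : ℝ≥0, u < 1 ∧ h u = k u ∧ ¬ ShareInitialSegment (h.shift u) (k.shift u) := by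
  set S : Set ℝ≥0 := {u | u ≤ 1 ∧ ∀ t ≤ u, h t = k t} with hS
  have hne : S.Nonempty := ⟨0, zero_le_one, fun t ht => by rwa [le_zero_iff.mp ht]⟩
  have hbdd : BddAbove S := ⟨1, fun u hu => hu.1⟩
  have hcl : IsClosed {t : ℝ≥0 | h t = k t} :=
    isClosed_eq h.isometry.continuous k.isometry.continuous
  have heq : h (sSup S) = k (sSup S) :=
    closure_minimal (fun u hu => hu.2 u le_rfl) hcl (csSup_mem_closure hne hbdd)
  have hle : sSup S ≤ 1 := csSup_le hne fun u hu => hu.1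
  have hlt : sSup S < 1 := hle.lt_of_ne fun h => h1 (h ▸ heq)
  refine ⟨sSup S, hlt, heq, ?_⟩
  rintro ⟨ε, hε, hshare⟩
  have hmem : min (sSup S + ε) 1 ∈ S := by
    refine ⟨min_le_right _ _, fun t ht => ?_⟩
    rcases lt_or_ge t (sSup S) with htS | htS
    · obtain ⟨v, hv, htv⟩ := exists_lt_of_lt_csSup hne htS
      exact hv.2 t htv.le
    · have := hshare (t - sSup S) (tsub_le_iff_left.mpr (ht.trans (min_le_left _ _)))
      simpa only [GeodesicRay.shift_apply, add_tsub_cancel_of_le htS] using this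
  exact absurd (le_csSup hbdd hmem) (not_le.mpr (lt_min (lt_add_of_pos_right _ hε) hlt))

theorem GeodesicLine.endpoint_ray {X : Type*} [MetricSpace X] (γ : GeodesicLine X) (a : ℝ) :
    (γ.ray a).endpoint = γ.backward.endpoint := by
  refine GeodesicRay.endpoint_eq_iff.mpr ⟨|a|, fun t => ?_⟩
  rw [γ.ray_apply, γ.backward_apply, γ.dist_eq]
  simp

theorem GeodesicRay.endpoint_shift {X : Type*} [MetricSpace X] (f : GeodesicRay X) (u : ℝ≥0) :
    (f.shift u).endpoint = f.endpoint := by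
  refine endpoint_eq_iff.mpr ⟨u, fun t => ?_⟩
  rw [f.shift_apply, f.dist_eq]
  push_cast
  rw [add_sub_cancel_right, abs_of_nonneg u.coe_nonneg]

/-- If two lines through a point are close in the forward direction, and if the backward rays seen
from a point of one of them span a fat triangle, then the lines are close in the backward
direction. -/
theorem GeodesicLine.exists_le_rayGromovProduct_backward {X : Type*} [MetricSpace X]
    [ProperSpace X] (hX : IsCATNegOne X) (K : Set.Iio (0 : ℝ))
    (htri : ∀ f g : GeodesicRay X, f 0 = g 0 → f.endpoint ≠ g.endpoint →
      ShareInitialSegment f g ∨ FatterThanComparison K f g) :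
    ∃ C : ℝ, 0 ≤ C ∧ ∀ (γ₁ γ₂ : GeodesicLine X) (A : ℝ), γ₁ 0 = γ₂ 0 → 0 ≤ A →
      (∀ t : ℝ≥0, t ≤ 1 → dist (γ₁ t) (γ₂ t) ≤ 12 * t * Real.exp (-A)) →
      ∀ (ℓ : ℝ≥0) (h : GeodesicRay X), 0 < ℓ → ℓ ≤ 1 → h 0 = γ₂ ℓ →
      h.endpoint = γ₁.backward.endpoint → ¬ ShareInitialSegment h (γ₂.ray ℓ) →
      ((A / √(-(K : ℝ)) - C : ℝ) : EReal) ≤ rayGromovProduct γ₁.backward γ₂.backward := by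
  -- 36 is 3 (`exists_asymptotic`) times 12 (forward closeness).
  obtain ⟨C, hC0, hC⟩ := GeodesicRay.le_rayGromovProduct_hypPlane K (M := 36) (by norm_num)
  refine ⟨C + 5, by positivity, fun γ₁ γ₂ A h0 hA hclose ℓ h hℓ hℓ1 hh0 hend hshare => ?_⟩
  have hk0 : h 0 = γ₂.ray ℓ 0 := by simpa using hh0
  have hℓ1' : (ℓ : ℝ) ≤ 1 := hℓ1
  have hℓ0 := ℓ.coe_nonneg
  obtain ⟨h', hh'0, hh'⟩ := GeodesicRay.exists_asymptotic hX (γ₁.ray ℓ) (γ₂ ℓ)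
  -- By uniqueness `h` is the ray just constructed, so it inherits the explicit bound on its
  -- distance to `γ₁`.
  have heq := GeodesicRay.eq_of_asymptotic hX (f := h) (g := h') (hh0.trans hh'0.symm) (by
    rw [hend, ← γ₁.endpoint_ray ℓ]
    exact (GeodesicRay.endpoint_eq_iff.mpr ⟨_, hh'⟩).symm)
  have hh : ∀ t, dist (h t) (γ₁ (ℓ - t)) ≤ 3 * dist (γ₁ ℓ) (γ₂ ℓ) := by
    intro t
    have := hh' t
    rwa [← heq, γ₁.ray_apply, γ₁.ray_apply, NNReal.coe_zero, sub_zero, dist_comm (γ₂ _)] at this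
  have hne : h.endpoint ≠ (γ₂.ray ℓ).endpoint := fun he =>
    hshare ⟨1, one_pos, fun t _ => GeodesicRay.eq_of_asymptotic hX hk0 he t⟩
  obtain ⟨f', g', h0', hprod, hfat⟩ := (htri h (γ₂.ray ℓ) hk0 hne).resolve_left hshare
  have hlow := hC f' g' h0' ℓ A hℓ hℓ1 hA (by
    refine (hfat ℓ ℓ).trans ?_
    have h1 := hh ℓ
    rw [sub_self, h0] at h1
    rw [γ₂.ray_apply, sub_self]
    linarith [hclose ℓ hℓ1])
  rw [hprod] at hlow
  obtain ⟨N, hN⟩ := GeodesicRay.exists_lt_gromovProduct hk0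
    ((EReal.coe_lt_coe_iff.mpr (sub_one_lt _)).trans_le hlow)
  -- Change of base point: at most `ℓ + 6 ℓ` in distance and `ℓ` in the time shift, halved, is at
  -- most 4. With the 1 spent on strictness this gives `C + 5`.
  refine GeodesicRay.le_rayGromovProduct (by simp [backward_apply, h0]) N fun s t hs ht => ?_
  have h1 := hN s (ℓ + t) hs (ht.trans le_add_self)
  have h2 : γ₂.ray ℓ (ℓ + t) = γ₂.backward t := by
    rw [γ₂.ray_apply, γ₂.backward_apply]
    congr 1
    push_cast
    ring
  rw [h2] at h1
  push_cast at h1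
  have h3 := dist_triangle4 (γ₁.backward s) (γ₁ (ℓ - s)) (h s) (γ₂.backward t)
  have h4 : dist (γ₁.backward s) (γ₁ (ℓ - s)) = ℓ := by
    rw [γ₁.backward_apply, γ₁.dist_eq, abs_of_nonpos (by linarith)]
    ring
  have h5 := hh s
  rw [dist_comm] at h5
  have h6 := dist_triangle (γ₁ ℓ) (γ₁ 0) (γ₂ ℓ)
  rw [h0, ← h0, γ₁.dist_eq, h0, γ₂.dist_eq, sub_zero, zero_sub, abs_neg, abs_of_nonneg hℓ0] at h6
  linarith

/-- Taking `A = a - 1` costs `R`. For `a ≤ 1` the left side is nonpositive, and for `a = ⊤`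
arbitrarily large `A` force `b = ⊤`. -/
theorem EReal.mul_sub_le_of_forall {R c : ℝ} (hR : 0 < R) (hc : 0 ≤ c) {a b : EReal} (hb : 0 ≤ b)
    (h : ∀ A : ℝ, 0 ≤ A → (A : EReal) < a → ((R * A - c : ℝ) : EReal) ≤ b) :
    (R : EReal) * a - ((c + R : ℝ) : EReal) ≤ b := by
  induction a with
  | bot => rw [EReal.coe_mul_bot_of_pos hR, EReal.bot_sub]; exact bot_le
  | top =>
    suffices b = ⊤ by rw [this]; exact le_top
    refine (EReal.eq_top_iff_forall_lt _).mpr fun y => ?_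
    refine lt_of_lt_of_le ?_ (h (max 0 ((y + c + 1) / R)) (le_max_left _ _) (EReal.coe_lt_top _))
    rw [EReal.coe_lt_coe_iff]
    have h1 := le_max_right 0 ((y + c + 1) / R)
    rw [div_le_iff₀' hR] at h1
    linarith
  | coe a =>
    rw [← EReal.coe_mul, ← EReal.coe_sub]
    rcases le_total a 1 with ha | ha
    · refine le_trans (EReal.coe_le_coe_iff.mpr ?_) hb
      nlinarith
    · have := h (a - 1) (by linarith) (EReal.coe_lt_coe_iff.mpr (sub_one_lt a))
      rwa [show R * (a - 1) - c = R * a - (c + R) by ring] at this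

/-! ### Bounded flip. -/

theorem mainTheorem7 {H : Type*} [MetricSpace H] [LocallyCompactSpace H]
    (hCAT : IsCATNegOne H) (hext : HasGeodesicExtension H)
    {G : Type*} [Group G] [MulAction G H] [IsIsometricSMul G H]
    (hG : ActsCocompactly G H)
    (K : ℝ) (hK : K < -1)
    (htri : ∀ f g : GeodesicRay H, f 0 = g 0 → f.endpoint ≠ g.endpoint →
      ShareInitialSegment f g ∨
        FatterThanComparison ⟨K, hK.trans (by norm_num)⟩ f g) :
    HasBoundedFlip H := by
  have : ProperSpace H := hG.properSpace hCAT.1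
  obtain ⟨C, hC0, hC⟩ := GeodesicLine.exists_le_rayGromovProduct_backward hCAT _ htri
  have hκ : 0 < √(-K) := Real.sqrt_pos.mpr (by linarith)
  refine ⟨1 / √(-K), C + 1 / √(-K), by positivity, by positivity, fun ζ ν p => ?_⟩
  obtain ⟨F, rfl⟩ := Quotient.exists_rep ζ
  obtain ⟨F', rfl⟩ := Quotient.exists_rep ν
  obtain ⟨f, hf0, hf⟩ := GeodesicRay.exists_asymptotic hCAT F p
  obtain ⟨g, hg0, hg⟩ := GeodesicRay.exists_asymptotic hCAT F' p
  have hfe : f.endpoint = F.endpoint := GeodesicRay.endpoint_eq_iff.mpr ⟨_, hf⟩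
  have hge : g.endpoint = F'.endpoint := GeodesicRay.endpoint_eq_iff.mpr ⟨_, hg⟩
  obtain ⟨γ₁, rfl⟩ := f.exists_extension hCAT hext
  obtain ⟨γ₂, rfl⟩ := g.exists_extension hCAT hext
  rw [GeodesicLine.forward_apply, NNReal.coe_zero] at hf0 hg0
  obtain ⟨h, hh0, hh⟩ := GeodesicRay.exists_asymptotic hCAT γ₁.backward (γ₂ 1)
  have hhe : h.endpoint = γ₁.backward.endpoint := GeodesicRay.endpoint_eq_iff.mpr ⟨_, hh⟩
  -- The question is whether `h` runs along `γ₂` from `γ₂ 1` back to `p`. If so, `γ₂` is replaced by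
  -- a line sharing its backward endpoint with `γ₁`.
  by_cases h1 : h 1 = γ₂.ray 1 1
  · rw [γ₂.ray_apply, NNReal.coe_one, sub_self] at h1
    obtain ⟨γ, hγf, hγb⟩ := hCAT.exists_line (f := γ₂.forward) (k := h.shift 1)
      (by simp [GeodesicLine.forward_apply, h1]) fun s => by
        rw [GeodesicLine.forward_apply, NNReal.coe_one, ← hh0, h.shift_apply, dist_comm,
          h.dist_zero]
        push_cast
        ring
    have hγ0 : γ 0 = p := by
      have : γ.forward 0 = γ₂.forward 0 := by rw [hγf]
      simpa [GeodesicLine.forward_apply, hg0] using this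
    refine ⟨γ₁, γ, hfe, by rw [hγf]; exact hge, hf0, hγ0, ?_⟩
    rw [GeodesicRay.rayGromovProduct_eq_top
      (by simp [GeodesicLine.backward_apply, hf0, hγ0])
      (by rw [hγb, GeodesicRay.endpoint_shift, hhe])]
    exact le_top
  -- The separation point is `γ₂ (1 - u)`, so `ℓ = 1 - u`; `u < 1` guarantees `ℓ > 0`.
  · obtain ⟨u, hu1, hu, hshare⟩ := GeodesicRay.exists_separation (by simp [hh0]) h1
    refine ⟨γ₁, γ₂, hfe, hge, hf0, hg0, ?_⟩
    have h0 : γ₁ 0 = γ₂ 0 := hf0.trans hg0.symm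
    refine EReal.mul_sub_le_of_forall (by positivity) hC0
      (GeodesicRay.rayGromovProduct_nonneg (by simp [GeodesicLine.backward_apply, h0]))
      fun A hA hAlt => ?_
    have hcoe : ((1 - u : ℝ≥0) : ℝ) = 1 - u := by rw [NNReal.coe_sub hu1.le, NNReal.coe_one]
    have hray : γ₂.ray ((1 - u : ℝ≥0) : ℝ) = (γ₂.ray 1).shift u := by
      simp only [GeodesicLine.ray, GeodesicRay.shift, GeodesicRay.mk.injEq]
      funext t
      congr 1
      rw [hcoe]
      push_cast
      ring
    have := hC γ₁ γ₂ A h0 hA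
      (fun t ht => GeodesicRay.dist_le_of_lt_rayGromovProduct hCAT
        (by simp [GeodesicLine.forward_apply, h0]) hAlt ht)
      (1 - u) (h.shift u) (tsub_pos_of_lt hu1) tsub_le_self
      (by rw [h.shift_apply, add_zero, hu, γ₂.ray_apply, hcoe])
      (by rw [GeodesicRay.endpoint_shift, hhe]) (by rwa [hray])
    rwa [div_mul_eq_mul_div, one_mul]
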